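/- Let $M$ be a smooth (Hausdorff, boundaryless) $n$-dimensional manifold with a smooth Riemannian metric $g$, and let $\nabla$ be a smooth torsion-free affine connection on $M$ such that $(X,Y,Z)\mapsto(\nabla_X g)(Y,Z)$ is totally symmetric, i.e. $(M,g,\nabla)$ is a statistical manifold. Let $\nabla^*$ be the dual connection, defined by $X\,g(Y,Z)=g(\nabla_XY,Z)+g(Y,\nabla^*_XZ)$, and for $\alpha\in\mathbb R$ put $\nabla^{(\alpha)}=\frac{1+\alpha}{2}\nabla+\frac{1-\alpha}{2}\nabla^*$. Let $\mathrm{Ric}^{(\alpha)}(Y,Z)=\mathrm{tr}\{X\mapsto R^{(\alpha)}(X,Y)Z\}$ be the Ricci tensor of $\nabla^{(\alpha)}$, where $R^{(\alpha)}$ is its curvature tensor. A torsion-free affine connection $D$ on $M$ is called (locally) equiaffine if every point of $M$ has an open neighbourhood on which there is a nowhere vanishing smooth $n$-form $\omega$ with $D\omega=0$. If there is a real $\alpha_0\neq0$ with $\mathrm{Ric}^{(\alpha_0)}=\mathrm{Ric}^{(-\alpha_0)}$ on $M$, then $\nabla^{(\alpha)}$ is torsion-free and (locally) equiaffine for every $\alpha\in\mathbb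 R$. -/

import Mathlib

open Bundle
open scoped Manifold ContDiff

noncomputable section

namespace StatisticalGeometry

/-- Affine connections on an `n`-dimensional manifold `M`, that is, covariant derivatives on the
tangent bundle. For `D : AffineConnection n M`, `D Y x v` is `(∇_v Y)(x)`. -/
abbrev AffineConnection (n : ℕ) (M : Type*) [TopologicalSpace M]
    [ChartedSpace (EuclideanSpace ℝ (Fin n)) M] [IsManifold (𝓡 n) ∞ M] :=
  CovariantDerivative (𝓡 n) (EuclideanSpace ℝ (Fin n))
    (fun x : M ↦ TangentSpace (𝓡 n) x)

variable {n : ℕ} {M : Type*} [TopologicalSpace M] [ChartedSpace (EuclideanSpace ℝ (Fin n)) M]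
  [IsManifold (𝓡 n) ∞ M]

instance (x : M) : FiniteDimensional ℝ (TangentSpace (𝓡 n) x) :=
  inferInstanceAs (FiniteDimensional ℝ (EuclideanSpace ℝ (Fin n)))

section Curvature

/-- The curvature `R(X, Y)Z = ∇_X ∇_Y Z - ∇_Y ∇_X Z - ∇_[X, Y] Z` of vector fields. -/
def curvatureField (D : AffineConnection n M) (X Y Z : Π x : M, TangentSpace (𝓡 n) x) (x : M) :
    TangentSpace (𝓡 n) x :=
  D (fun y ↦ D Z y (Y y)) x (X x) - D (fun y ↦ D Z y (X y)) x (Y x)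
    - D Z x (VectorField.mlieBracket (𝓡 n) X Y x)

/-- The curvature `R(u, v)w` of tangent vectors at `x`, computed with extensions of `u`, `v`, `w`
to vector fields which are smooth near `x`. -/
def curvature (D : AffineConnection n M) (x : M) (u v w : TangentSpace (𝓡 n) x) :
    TangentSpace (𝓡 n) x :=
  curvatureField D (FiberBundle.extend (EuclideanSpace ℝ (Fin n)) u)
    (FiberBundle.extend (EuclideanSpace ℝ (Fin n)) v)
    (FiberBundle.extend (EuclideanSpace ℝ (Fin n)) w) x

end Curvature

section Equiaffine

/-- A field of alternating `n`-forms on the tangent spaces of `M`. -/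
abbrev TopForm (n : ℕ) (M : Type*) [TopologicalSpace M]
    [ChartedSpace (EuclideanSpace ℝ (Fin n)) M] :=
  Π x : M, TangentSpace (𝓡 n) x [⋀^Fin n]→ₗ[ℝ] ℝ

/-- The vector field `X` is smooth on the set `U`. -/
def SmoothFieldOn (U : Set M) (X : Π x : M, TangentSpace (𝓡 n) x) : Prop :=
  ContMDiffOn (𝓡 n) (𝓡 n).tangent ∞ (fun x ↦ (⟨x, X x⟩ : TangentBundle (𝓡 n) M)) U

/-- `η` is a volume form on `U`: it is smooth on `U` (it sends smooth vector fields to smooth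
functions) and it vanishes at no point of `U`. -/
structure IsVolumeFormOn (η : TopForm n M) (U : Set M) : Prop where
  smooth : ∀ X : Fin n → Π x : M, TangentSpace (𝓡 n) x, (∀ i, SmoothFieldOn U (X i)) →
    ContMDiffOn (𝓡 n) 𝓘(ℝ, ℝ) ∞ (fun x ↦ η x (fun i ↦ X i x)) U
  ne_zero : ∀ x ∈ U, η x ≠ 0

/-- `(∇_v η)(X₁, …, Xₙ) = v(η(X₁, …, Xₙ)) - ∑ i, η(X₁, …, ∇_v Xᵢ, …, Xₙ)` at `x`. -/
def covDerivForm (D : AffineConnection n M) (η : TopForm n M)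
    (X : Fin n → Π x : M, TangentSpace (𝓡 n) x) (x : M) (v : TangentSpace (𝓡 n) x) : ℝ :=
  mvfderiv (𝓡 n) (fun y : M ↦ η y (fun i ↦ X i y)) x v
    - ∑ i, η x (Function.update (fun j ↦ X j x) i (D (X i) x v))

/-- `∇η = 0` on `U`. -/
def IsParallelOn (D : AffineConnection n M) (η : TopForm n M) (U : Set M) : Prop :=
  ∀ X : Fin n → Π x : M, TangentSpace (𝓡 n) x, (∀ i, SmoothFieldOn U (X i)) →
    ∀ x ∈ U, ∀ v : TangentSpace (𝓡 n) x, covDerivForm D η X x v = 0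

/-- A (locally) equiaffine connection: it is torsion-free, and every point has an open neighbourhood
which carries a parallel volume form. -/
structure IsEquiaffine (D : AffineConnection n M) : Prop where
  torsion_eq_zero : D.torsion = 0
  exists_parallel : ∀ x : M, ∃ U : Set M, IsOpen U ∧ x ∈ U ∧
    ∃ η : TopForm n M, IsVolumeFormOn η U ∧ IsParallelOn D η U

end Equiaffine

section Riesz

variable {E : Type*} [NormedAddCommGroup E] [InnerProductSpace ℝ E] [FiniteDimensional ℝ E]

set_option synthInstance.maxHeartbeats 200000 in
/-- The bilinear map `K` with `⟪K w u, v⟫ = Q w v u`. -/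
def rieszBilinear (Q : E →L[ℝ] E →L[ℝ] E →L[ℝ] ℝ) : E →L[ℝ] E →L[ℝ] E :=
  haveI : CompleteSpace E := FiniteDimensional.complete ℝ E
  LinearMap.toContinuousBilinearMap <| LinearMap.mk₂ ℝ
    (fun w u ↦ (InnerProductSpace.toDual ℝ E).symm ((Q w).flip u))
    (fun w w' u ↦ ext_inner_right ℝ fun v ↦ by simp [inner_add_left])
    (fun c w u ↦ ext_inner_right ℝ fun v ↦ by simp [inner_smul_left])
    (fun w u u' ↦ ext_inner_right ℝ fun v ↦ by simp [inner_add_left])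
    (fun c w u ↦ ext_inner_right ℝ fun v ↦ by simp [inner_smul_left])

theorem inner_rieszBilinear (Q : E →L[ℝ] E →L[ℝ] E →L[ℝ] ℝ) (u v w : E) :
    inner ℝ (rieszBilinear Q w u) v = Q w v u := by
  have : CompleteSpace E := FiniteDimensional.complete ℝ E
  exact InnerProductSpace.toDual_symm_apply

end Riesz

section Statistical

variable [RiemannianBundle (fun x : M ↦ TangentSpace (𝓡 n) x)]

/-- The Ricci curvature `Ric(v, w) = tr_g {(u, u') ↦ g(R(u, v)w, u')}`. -/
def ricci (D : AffineConnection n M) (x : M) (v w : TangentSpace (𝓡 n) x) : ℝ :=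
  ∑ i, inner ℝ (curvature D x (stdOrthonormalBasis ℝ (TangentSpace (𝓡 n) x) i) v w)
    (stdOrthonormalBasis ℝ (TangentSpace (𝓡 n) x) i)

variable [IsContMDiffRiemannianBundle (𝓡 n) ∞ (EuclideanSpace ℝ (Fin n))
    (fun x : M ↦ TangentSpace (𝓡 n) x)]

instance : IsContMDiffRiemannianBundle (𝓡 n) 1 (EuclideanSpace ℝ (Fin n))
    (fun x : M ↦ TangentSpace (𝓡 n) x) :=
  IsContMDiffRiemannianBundle.of_le (n := ∞) (by simp)

/-- The cubic form `Q(u, v, w) = (∇_u g)(v, w)`. -/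
def cubicForm (D : AffineConnection n M) (x : M) (u v w : TangentSpace (𝓡 n) x) : ℝ :=
  D.derivMetricTensor x v w u

/-- `(M, g, ∇)` is a statistical manifold: `∇` is smooth and torsion-free, and the cubic form
`∇g` is totally symmetric. -/
structure IsStatistical (D : AffineConnection n M) : Prop where
  smooth : D.ContMDiffCovariantDerivative ∞
  torsion_eq_zero : D.torsion = 0
  cubicForm_swap_left : ∀ (x : M) (u v w : TangentSpace (𝓡 n) x),
    cubicForm D x u v w = cubicForm D x v u w
  cubicForm_swap_right : ∀ (x : M) (u v w : TangentSpace (𝓡 n) x),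
    cubicForm D x u v w = cubicForm D x u w v

/-- The difference tensor `(w, u) ↦ K(u, w)` between the dual connection and `∇`, determined by
`g(K(u, w), v) = (∇_u g)(w, v)`. -/
def dualDifference (D : AffineConnection n M) (x : M) :
    TangentSpace (𝓡 n) x →L[ℝ] TangentSpace (𝓡 n) x →L[ℝ] TangentSpace (𝓡 n) x :=
  rieszBilinear (D.derivMetricTensor x)

theorem inner_dualDifference (D : AffineConnection n M) (x : M)
    (u v w : TangentSpace (𝓡 n) x) :
    inner ℝ (dualDifference D x w u) v = cubicForm D x u w v :=
  inner_rieszBilinear _ _ _ _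

/-- The dual connection `∇*` of `∇` with respect to the metric. -/
def dual (D : AffineConnection n M) : AffineConnection n M :=
  D.addOneForm (dualDifference D)

/-- The dual connection satisfies `v g(Y, Z) = g(∇_v Y, Z) + g(Y, ∇*_v Z)`, which
characterizes it. -/
theorem dual_spec (D : AffineConnection n M) {x : M} {Y Z : Π x : M, TangentSpace (𝓡 n) x}
    (hY : MDifferentiableAt (𝓡 n) (𝓡 n).tangent (fun y ↦ (⟨y, Y y⟩ : TangentBundle (𝓡 n) M)) x)
    (hZ : MDifferentiableAt (𝓡 n) (𝓡 n).tangent (fun y ↦ (⟨y, Z y⟩ : TangentBundle (𝓡 n) M)) x)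
    (v : TangentSpace (𝓡 n) x) :
    mvfderiv (𝓡 n) (fun y : M ↦ (inner ℝ (Y y) (Z y) : ℝ)) x v =
      inner ℝ (D Y x v) (Z x) + inner ℝ (Y x) (dual D Z x v) := by
  have h := D.derivMetricTensor_apply (X := FiberBundle.extend (EuclideanSpace ℝ (Fin n)) v) x hZ hY
  have h' := inner_dualDifference D x v (Y x) (Z x)
  have e : (fun y : M ↦ (inner ℝ (Y y) (Z y) : ℝ)) = fun y ↦ inner ℝ (Z y) (Y y) :=
    funext fun y ↦ real_inner_comm _ _
  change _ = _ + inner ℝ (Y x) (D Z x v + dualDifference D x (Z x) v)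
  rw [inner_add_right, real_inner_comm (dualDifference D x (Z x) v)]
  beta_reduce at h
  rw [FiberBundle.extend_apply_self] at h
  rw [h', cubicForm, h, e, real_inner_comm (D Z x v), real_inner_comm (Z x) (D Y x v)]
  ring

/-- The `α`-connection `∇^(α) = (1 + α)/2 ∇ + (1 - α)/2 ∇*`. -/
def alphaConnection (D : AffineConnection n M) (α : ℝ) : AffineConnection n M :=
  D.affineCombination (dual D) (fun _ ↦ (1 + α) / 2)

theorem alphaConnection_apply (D : AffineConnection n M) (α : ℝ)
    (Y : Π x : M, TangentSpace (𝓡 n) x) (x : M) (v : TangentSpace (𝓡 n) x) :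
    alphaConnection D α Y x v = ((1 + α) / 2) • D Y x v + ((1 - α) / 2) • dual D Y x v := by
  have h : (1 - α) / 2 = 1 - (1 + α) / 2 := by ring
  rw [h]
  rfl

end Statistical

end StatisticalGeometry

end

/-! Let `K` = `dualDifference`, so that `∇* = ∇ + K` and `g(K(·,·),·)` is the totally symmetric
cubic form. The 0-connection `∇⁰` is metric and torsion-free, and `∇^(α) = ∇⁰ - (α/2) K`. In the
curvature of `∇^(α)` only the part linear in `α` is odd, hence `R^(α)(X,Y)Z - R^(-α)(X,Y)Z = -α
((∇⁰_X K)(Z,Y) - (∇⁰_Y K)(Z,X))`. Let `τ(v) = tr K(v,·)`. Tracing over `X`, equality of the Ricci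
tensors for some `α₀ ≠ 0` says `(div K)(Y,Z) = (∇⁰_Y τ)(Z)`. By symmetry of `K` the left side is
symmetric in `Y`, `Z`; hence so is `∇⁰τ`, and since `∇⁰` is torsion-free, `dτ = 0`.

By the Poincaré lemma `τ = df` locally. A metric volume form `vol` satisfies `∇⁰vol = 0`, so
`∇^(α)_v vol = (α/2) τ(v) vol`, and `exp(-(α/2) f) vol` is parallel for every `α`.

The chain is `inner_curvatureField_sub`, `sum_derivCubic_comm`, `mvfderiv_traceForm`,
`traceForm_closed`, `exists_potential`, `isParallelOn_frameForm`. Local orthonormal frames supply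
the regularity of `K` and `τ`, the traces and the volume form. -/

namespace StatisticalGeometry

/-! ### Regularity of vector fields and calculus rules for connections -/

section Differentiability

variable {n : ℕ} {M : Type*} [TopologicalSpace M] [ChartedSpace (EuclideanSpace ℝ (Fin n)) M]

/-- The function `f` is differentiable at `x`. -/
abbrev DiffAt (n : ℕ) {M : Type*} [TopologicalSpace M] [ChartedSpace (EuclideanSpace ℝ (Fin n)) M]
    (f : M → ℝ) (x : M) : Prop :=
  MDifferentiableAt (𝓡 n) 𝓘(ℝ, ℝ) f x

/-- The vector field `X` is differentiable at `x`. -/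
abbrev DiffFieldAt [IsManifold (𝓡 n) ∞ M] (X : Π x : M, TangentSpace (𝓡 n) x) (x : M) : Prop :=
  MDifferentiableAt (𝓡 n) (𝓡 n).tangent (fun y ↦ (⟨y, X y⟩ : TangentBundle (𝓡 n) M)) x

variable [IsManifold (𝓡 n) ∞ M] {U : Set M} {x : M} {X : Π x : M, TangentSpace (𝓡 n) x}

theorem SmoothFieldOn.diffFieldAt (hX : SmoothFieldOn U X) (hU : IsOpen U) (hx : x ∈ U) :
    DiffFieldAt X x :=
  ((hX x hx).contMDiffAt (hU.mem_nhds hx)).mdifferentiableAt (by simp)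

theorem diffFieldAt_extend (v : TangentSpace (𝓡 n) x) :
    DiffFieldAt (FiberBundle.extend (EuclideanSpace ℝ (Fin n)) v) x :=
  FiberBundle.mdifferentiableAt_extend ..

theorem exists_smoothFieldOn_extend (v : TangentSpace (𝓡 n) x) :
    ∃ U : Set M, IsOpen U ∧ x ∈ U ∧
      SmoothFieldOn U (FiberBundle.extend (EuclideanSpace ℝ (Fin n)) v) := by
  obtain ⟨s, hs, h⟩ := FiberBundle.exists_contMDiffOn_extend (k := ∞) (𝓡 n)
    (EuclideanSpace ℝ (Fin n)) v
  obtain ⟨U, hUs, hU, hx⟩ := mem_nhds_iff.1 hs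
  exact ⟨U, hU, hx, h.mono hUs⟩

variable {f g : M → ℝ} {Y : Π x : M, TangentSpace (𝓡 n) x}

theorem DiffFieldAt.smul (hf : DiffAt n f x) (hX : DiffFieldAt X x) :
    DiffFieldAt (fun y ↦ f y • X y) x :=
  hf.smul_section hX

theorem DiffFieldAt.sum {ι : Type*} {s : Finset ι} {X : ι → Π x : M, TangentSpace (𝓡 n) x}
    (hX : ∀ i ∈ s, DiffFieldAt (X i) x) : DiffFieldAt (fun y ↦ ∑ i ∈ s, X i y) x :=
  .sum_section hX

theorem SmoothFieldOn.smul (hf : ContMDiffOn (𝓡 n) 𝓘(ℝ, ℝ) ∞ f U) (hX : SmoothFieldOn U X) :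
    SmoothFieldOn U (fun y ↦ f y • X y) :=
  hf.smul_section hX

theorem SmoothFieldOn.sum {ι : Type*} {s : Finset ι} {X : ι → Π x : M, TangentSpace (𝓡 n) x}
    (hX : ∀ i ∈ s, SmoothFieldOn U (X i)) : SmoothFieldOn U (fun y ↦ ∑ i ∈ s, X i y) :=
  .sum_section hX

theorem SmoothFieldOn.add (hX : SmoothFieldOn U X) (hY : SmoothFieldOn U Y) :
    SmoothFieldOn U (fun y ↦ X y + Y y) :=
  ContMDiffOn.add_section hX hY

theorem SmoothFieldOn.sub (hX : SmoothFieldOn U X) (hY : SmoothFieldOn U Y) :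
    SmoothFieldOn U (fun y ↦ X y - Y y) :=
  ContMDiffOn.sub_section hX hY

variable (D : AffineConnection n M)

theorem connection_add (hX : DiffFieldAt X x) (hY : DiffFieldAt Y x) (v : TangentSpace (𝓡 n) x) :
    D (fun y ↦ X y + Y y) x v = D X x v + D Y x v :=
  congr($(D.isCovariantDerivativeOnUniv.add hX hY) v)

theorem connection_smul (hf : DiffAt n f x) (hX : DiffFieldAt X x) (v : TangentSpace (𝓡 n) x) :
    D (fun y ↦ f y • X y) x v = f x • D X x v + mvfderiv (𝓡 n) f x v • X x :=
  congr($(D.isCovariantDerivativeOnUniv.leibniz hX hf) v)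

theorem connection_const_smul (c : ℝ) (hX : DiffFieldAt X x) (v : TangentSpace (𝓡 n) x) :
    D (fun y ↦ c • X y) x v = c • D X x v :=
  congr($(D.isCovariantDerivativeOnUniv.smul_const c hX) v)

theorem connection_sub (hX : DiffFieldAt X x) (hY : DiffFieldAt Y x) (v : TangentSpace (𝓡 n) x) :
    D (fun y ↦ X y - Y y) x v = D X x v - D Y x v := by
  have h := connection_add D hX (DiffFieldAt.smul (f := fun _ ↦ -1) mdifferentiableAt_const hY) v
  rw [connection_const_smul D _ hY] at h
  simpa [sub_eq_add_neg] using h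

theorem connection_congr (hX : DiffFieldAt X x) (hY : DiffFieldAt Y x)
    (h : ∀ᶠ y in nhds x, X y = Y y) : D X x = D Y x :=
  D.isCovariantDerivativeOnUniv.congr_of_eventuallyEq hX hY Filter.univ_mem h

end Differentiability

/-! ### The `α`-connections and the Levi-Civita connection -/

section LeviCivita

variable {n : ℕ} {M : Type*} [TopologicalSpace M] [ChartedSpace (EuclideanSpace ℝ (Fin n)) M]
  [IsManifold (𝓡 n) ∞ M] [RiemannianBundle (fun x : M ↦ TangentSpace (𝓡 n) x)]
  [IsContMDiffRiemannianBundle (𝓡 n) ∞ (EuclideanSpace ℝ (Fin n))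
    (fun x : M ↦ TangentSpace (𝓡 n) x)]
  {D : AffineConnection n M}

theorem dual_apply (D : AffineConnection n M) (Y : Π x : M, TangentSpace (𝓡 n) x) (x : M)
    (v : TangentSpace (𝓡 n) x) :
    dual D Y x v = D Y x v + dualDifference D x (Y x) v := rfl

theorem alphaConnection_eq_add (D : AffineConnection n M) (α : ℝ)
    (Y : Π x : M, TangentSpace (𝓡 n) x) (x : M) (v : TangentSpace (𝓡 n) x) :
    alphaConnection D α Y x v = D Y x v + ((1 - α) / 2) • dualDifference D x (Y x) v := by
  rw [alphaConnection_apply, dual_apply]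
  module

/-- The `α`-connection in terms of the `0`-connection, which is the Levi-Civita connection. -/
theorem alphaConnection_eq_sub (D : AffineConnection n M) (α : ℝ)
    (Y : Π x : M, TangentSpace (𝓡 n) x) (x : M) (v : TangentSpace (𝓡 n) x) :
    alphaConnection D α Y x v =
      alphaConnection D 0 Y x v - (α / 2) • dualDifference D x (Y x) v := by
  rw [alphaConnection_eq_add, alphaConnection_eq_add]
  module

/-- Metric compatibility of the 0-connection: it is the mean of `∇` and `∇*`, so the identity is the
average of the duality relation for `(Y, Z)` and for `(Z, Y)`. -/
theorem mvfderiv_inner_eq (D : AffineConnection n M) {x : M} {Y Z : Π x : M, TangentSpace (𝓡 n) x}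
    (hY : DiffFieldAt Y x) (hZ : DiffFieldAt Z x) (v : TangentSpace (𝓡 n) x) :
    mvfderiv (𝓡 n) (fun y : M ↦ (inner ℝ (Y y) (Z y) : ℝ)) x v =
      inner ℝ (alphaConnection D 0 Y x v) (Z x) + inner ℝ (Y x) (alphaConnection D 0 Z x v) := by
  have h₁ := dual_spec D hY hZ v
  have h₂ := dual_spec D hZ hY v
  have e : (fun y : M ↦ (inner ℝ (Y y) (Z y) : ℝ)) = fun y ↦ inner ℝ (Z y) (Y y) :=
    funext fun y ↦ real_inner_comm _ _
  rw [← e] at h₂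
  simp only [alphaConnection_apply, inner_add_right, inner_smul_right, real_inner_comm (Y x),
    real_inner_comm (Z x)] at h₁ h₂ ⊢
  simp
  linarith

theorem IsStatistical.dualDifference_comm (hD : IsStatistical D) (x : M)
    (u v : TangentSpace (𝓡 n) x) : dualDifference D x u v = dualDifference D x v u :=
  ext_inner_right ℝ fun w ↦ by
    rw [inner_dualDifference, inner_dualDifference, hD.cubicForm_swap_left]

theorem IsStatistical.inner_dualDifference_comm (hD : IsStatistical D) (x : M)
    (u v w : TangentSpace (𝓡 n) x) :
    (inner ℝ (dualDifference D x u v) w : ℝ) = inner ℝ (dualDifference D x w v) u := by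
  rw [inner_dualDifference, inner_dualDifference, hD.cubicForm_swap_right]

/-- The torsions of `∇^(α)` and `∇` differ by the antisymmetrization of a multiple of `K`, which is
symmetric. -/
theorem IsStatistical.torsion_alphaConnection (hD : IsStatistical D) (α : ℝ) :
    (alphaConnection D α).torsion = 0 := by
  rw [CovariantDerivative.torsion_eq_zero_iff]
  intro X Y x hX hY
  rw [← (D.torsion_eq_zero_iff.1 hD.torsion_eq_zero) hX hY, alphaConnection_eq_add,
    alphaConnection_eq_add, hD.dualDifference_comm x (X x)]
  abel

theorem IsStatistical.mlieBracket_eq (hD : IsStatistical D) (α : ℝ) {x : M}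
    {X Y : Π x : M, TangentSpace (𝓡 n) x} (hX : DiffFieldAt X x) (hY : DiffFieldAt Y x) :
    VectorField.mlieBracket (𝓡 n) X Y x =
      alphaConnection D α Y x (X x) - alphaConnection D α X x (Y x) :=
  ((alphaConnection D α).torsion_eq_zero_iff.1 (hD.torsion_alphaConnection α) hX hY).symm

end LeviCivita

/-! ### Smooth connections on open sets -/

section Localization

variable {n : ℕ} {M : Type*} [TopologicalSpace M] [T2Space M]
  [ChartedSpace (EuclideanSpace ℝ (Fin n)) M] [IsManifold (𝓡 n) ∞ M]
  {U : Set M}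

/-- A smooth connection sends vector fields smooth on an open set to vector fields smooth there. -/
theorem SmoothFieldOn.connection {D : AffineConnection n M}
    (hD : D.ContMDiffCovariantDerivative ∞) (hU : IsOpen U) {X Y : Π x : M, TangentSpace (𝓡 n) x}
    (hX : SmoothFieldOn U X) (hY : SmoothFieldOn U Y) : SmoothFieldOn U (fun x ↦ D Y x (X x)) := by
  intro x hx
  -- Smoothness of the connection concerns globally smooth fields, so `Y` is cut off by a bump
  -- function supported in `U`. The product `Z` equals `Y` near `x`, hence near every `y` close to
  -- `x`, and the connection sees only germs.
  obtain ⟨ψ, -, hψU⟩ :=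
    (SmoothBumpFunction.nhds_basis_tsupport (I := 𝓡 n) x).mem_iff.1 (hU.mem_nhds hx)
  have hψ : ContMDiff (𝓡 n) 𝓘(ℝ, ℝ) ∞ ψ := ψ.contMDiff
  have hZ := ContMDiffOn.smul_section_of_tsupport hψ.contMDiffOn hU hψU hY
  set Z : Π x : M, TangentSpace (𝓡 n) x := (ψ : M → ℝ) • Y with hZdef
  have hZ' : ∀ᶠ y in nhds x, Z y = Y y := ψ.eventuallyEq_one.mono fun y hy ↦ by simp [hZdef, hy]
  have hDZ := hD.contMDiff.contMDiff (σ := Z) (by simpa using hZ.contMDiffOn)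
  have key := ContMDiffWithinAt.clm_bundle_apply (hDZ.mono (Set.subset_univ U) x hx) (hX x hx)
  refine key.congr_of_eventuallyEq_of_mem ?_ hx
  filter_upwards [nhdsWithin_le_nhds hZ'.eventually_nhds, self_mem_nhdsWithin] with y hy hyU
  have hZy : DiffFieldAt Z y := (hZ y).mdifferentiableAt (by simp)
  have := connection_congr D hZy (hY.diffFieldAt hU hyU) hy
  simp only [this]

end Localization

/-! ### Local orthonormal frames -/

section Frame

theorem finrank_tangentSpace {n : ℕ} {M : Type*} [TopologicalSpace M]
    [ChartedSpace (EuclideanSpace ℝ (Fin n)) M] (x : M) :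
    Module.finrank ℝ (TangentSpace (𝓡 n) x) = n :=
  finrank_euclideanSpace_fin (𝕜 := ℝ)

variable {n : ℕ} {M : Type*} [TopologicalSpace M] [ChartedSpace (EuclideanSpace ℝ (Fin n)) M]
  [IsManifold (𝓡 n) ∞ M] [RiemannianBundle (fun x : M ↦ TangentSpace (𝓡 n) x)]

/-- The vector fields `F i` are smooth on `U` and form an orthonormal basis at every point
of `U`. -/
structure IsOrthonormalFrameOn {ι : Type*} [Fintype ι] (F : ι → Π x : M, TangentSpace (𝓡 n) x)
    (U : Set M) : Prop where
  card_eq : Fintype.card ι = n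
  smooth : ∀ i, SmoothFieldOn U (F i)
  orthonormal : ∀ x ∈ U, Orthonormal ℝ (fun i ↦ F i x)

namespace IsOrthonormalFrameOn

variable {ι : Type*} [Fintype ι] {F : ι → Π x : M, TangentSpace (𝓡 n) x} {U V : Set M} {x : M}

theorem mono (hF : IsOrthonormalFrameOn F U) (h : V ⊆ U) : IsOrthonormalFrameOn F V :=
  ⟨hF.card_eq, fun i ↦ (hF.smooth i).mono h, fun x hx ↦ hF.orthonormal x (h hx)⟩

theorem exists_orthonormalBasis (hF : IsOrthonormalFrameOn F U) (hx : x ∈ U) :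
    ∃ b : OrthonormalBasis ι ℝ (TangentSpace (𝓡 n) x), ∀ i, b i = F i x := by
  have h := hF.orthonormal x hx
  have hs := h.linearIndependent.span_eq_top_of_card_eq_finrank'
    (hF.card_eq.trans (finrank_tangentSpace x).symm)
  exact ⟨OrthonormalBasis.mk h hs.ge, fun i ↦ by simp⟩

theorem sum_inner_smul (hF : IsOrthonormalFrameOn F U) (hx : x ∈ U) (v : TangentSpace (𝓡 n) x) :
    ∑ i, (inner ℝ (F i x) v : ℝ) • F i x = v := by
  obtain ⟨b, hb⟩ := hF.exists_orthonormalBasis hx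
  simpa [hb] using b.sum_repr' v

theorem sum_inner_mul_inner (hF : IsOrthonormalFrameOn F U) (hx : x ∈ U)
    (v w : TangentSpace (𝓡 n) x) :
    ∑ i, (inner ℝ v (F i x) : ℝ) * inner ℝ (F i x) w = inner ℝ v w := by
  obtain ⟨b, hb⟩ := hF.exists_orthonormalBasis hx
  simpa [hb] using b.sum_inner_mul_inner v w

theorem inner_eq [DecidableEq ι] (hF : IsOrthonormalFrameOn F U) (hx : x ∈ U) (i j : ι) :
    (inner ℝ (F i x) (F j x) : ℝ) = if i = j then 1 else 0 :=
  orthonormal_iff_ite.1 (hF.orthonormal x hx) i j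

/-- A constant rotation of an orthonormal frame takes any prescribed orthonormal value at `x`. -/
theorem exists_eq_at (hF : IsOrthonormalFrameOn F U) (hx : x ∈ U) {κ : Type*} [Fintype κ]
    (e : OrthonormalBasis κ ℝ (TangentSpace (𝓡 n) x)) :
    ∃ G : κ → Π x : M, TangentSpace (𝓡 n) x, IsOrthonormalFrameOn G U ∧ ∀ k, G k x = e k := by
  classical
  refine ⟨fun k y ↦ ∑ i, (inner ℝ (F i x) (e k) : ℝ) • F i y, ⟨?_, fun k ↦ ?_, fun y hy ↦ ?_⟩,
    fun k ↦ hF.sum_inner_smul hx _⟩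
  · exact (Module.finrank_eq_card_basis e.toBasis).symm.trans (finrank_tangentSpace x)
  · exact SmoothFieldOn.sum fun i _ ↦ SmoothFieldOn.smul contMDiffOn_const (hF.smooth i)
  · rw [orthonormal_iff_ite]
    intro k l
    -- The Gram matrix of the rotated frame at `y` depends only on the constant coefficients, so it
    -- equals that at `x`, which is the identity.
    rw [← orthonormal_iff_ite.1 e.orthonormal k l, ← hF.sum_inner_mul_inner hx (e k) (e l)]
    simp [sum_inner, inner_sum, inner_smul_left, inner_smul_right, hF.inner_eq hy,
      real_inner_comm (e k), mul_comm]

end IsOrthonormalFrameOn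

variable [IsContMDiffRiemannianBundle (𝓡 n) ∞ (EuclideanSpace ℝ (Fin n))
    (fun x : M ↦ TangentSpace (𝓡 n) x)] {U : Set M}

theorem SmoothFieldOn.contMDiffOn_inner {X Y : Π x : M, TangentSpace (𝓡 n) x} (hX : SmoothFieldOn U X)
    (hY : SmoothFieldOn U Y) :
    ContMDiffOn (𝓡 n) 𝓘(ℝ, ℝ) ∞ (fun x ↦ (inner ℝ (X x) (Y x) : ℝ)) U :=
  ContMDiffOn.inner_bundle hX hY

theorem DiffFieldAt.diffAt_inner {x : M} {X Y : Π x : M, TangentSpace (𝓡 n) x} (hX : DiffFieldAt X x)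
    (hY : DiffFieldAt Y x) : DiffAt n (fun x ↦ (inner ℝ (X x) (Y x) : ℝ)) x :=
  MDifferentiableAt.inner_bundle hX hY

/-- Strong induction on the recursion: each coefficient is a quotient of inner products of smooth
fields, and independence keeps the denominators nonzero. -/
theorem SmoothFieldOn.gramSchmidt {m : ℕ} {X : Fin m → Π x : M, TangentSpace (𝓡 n) x}
    (hX : ∀ i, SmoothFieldOn U (X i))
    (hli : ∀ x ∈ U, LinearIndependent ℝ (fun i ↦ X i x)) (i : Fin m) :
    SmoothFieldOn U (fun x ↦ InnerProductSpace.gramSchmidt ℝ (fun j ↦ X j x) i) := by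
  induction i using WellFoundedLT.induction with
  | ind i ih =>
    have e : (fun x ↦ InnerProductSpace.gramSchmidt ℝ (fun j ↦ X j x) i) = fun x ↦ X i x -
        ∑ j ∈ Finset.Iio i,
          ((inner ℝ (InnerProductSpace.gramSchmidt ℝ (fun j ↦ X j x) j) (X i x) : ℝ) /
            inner ℝ (InnerProductSpace.gramSchmidt ℝ (fun j ↦ X j x) j)
              (InnerProductSpace.gramSchmidt ℝ (fun j ↦ X j x) j)) •
          InnerProductSpace.gramSchmidt ℝ (fun j ↦ X j x) j := by
      funext x
      rw [eq_sub_iff_add_eq, eq_comm]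
      simpa only [real_inner_self_eq_norm_sq] using!
        InnerProductSpace.gramSchmidt_def'' ℝ (fun j ↦ X j x) i
    rw [e]
    refine (hX i).sub (SmoothFieldOn.sum fun j hj ↦ ?_)
    have hj := ih j (Finset.mem_Iio.1 hj)
    refine SmoothFieldOn.smul ?_ hj
    refine ContMDiffOn.div₀ (hj.contMDiffOn_inner (hX i)) (hj.contMDiffOn_inner hj) fun x hx ↦ ?_
    exact inner_self_ne_zero.2 (InnerProductSpace.gramSchmidt_ne_zero _ (hli x hx))

variable (x₀ : M)

theorem exists_isOrthonormalFrameOn : ∃ U : Set M, IsOpen U ∧ x₀ ∈ U ∧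
    ∃ F : Fin n → Π x : M, TangentSpace (𝓡 n) x, IsOrthonormalFrameOn F U := by
  let t := trivializationAt (EuclideanSpace ℝ (Fin n)) (fun x : M ↦ TangentSpace (𝓡 n) x) x₀
  let b := (EuclideanSpace.basisFun (Fin n) ℝ).toBasis
  have h := t.isLocalFrameOn_localFrame_baseSet (𝓡 n) ∞ b
  have hs : ∀ i, SmoothFieldOn t.baseSet (t.localFrame b i) := h.contMDiffOn
  have hli : ∀ x ∈ t.baseSet, LinearIndependent ℝ (fun i ↦ t.localFrame b i x) :=
    fun x hx ↦ h.linearIndependent hx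
  refine ⟨t.baseSet, t.open_baseSet, FiberBundle.mem_baseSet_trivializationAt' x₀,
    fun i x ↦ InnerProductSpace.gramSchmidtNormed ℝ (fun j ↦ t.localFrame b j x) i,
    by simp, fun i ↦ ?_, fun x hx ↦ InnerProductSpace.gramSchmidtNormed_orthonormal (hli x hx)⟩
  have hg := SmoothFieldOn.gramSchmidt hs hli i
  refine SmoothFieldOn.smul (f := fun x ↦
    ‖InnerProductSpace.gramSchmidt ℝ (fun j ↦ t.localFrame b j x) i‖⁻¹) ?_ hg
  have hsq := hg.contMDiffOn_inner hg
  intro x hx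
  have hne := InnerProductSpace.gramSchmidt_ne_zero (𝕜 := ℝ) i (hli x hx)
  have hne' := inner_self_ne_zero (𝕜 := ℝ).2 hne
  -- The normalizing factor is the inverse square root of a nonvanishing smooth function, hence
  -- smooth.
  have hr : ContDiffAt ℝ ∞ (fun s : ℝ ↦ (√s)⁻¹)
      (inner ℝ (InnerProductSpace.gramSchmidt ℝ (fun j ↦ t.localFrame b j x) i)
        (InnerProductSpace.gramSchmidt ℝ (fun j ↦ t.localFrame b j x) i)) :=
    (Real.contDiffAt_sqrt hne').inv
      (by rw [real_inner_self_eq_norm_sq, Real.sqrt_sq (norm_nonneg _)]; exact norm_ne_zero_iff.2 hne)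
  refine (hr.contMDiffAt.comp_contMDiffWithinAt x (hsq x hx)).congr (fun y _ ↦ ?_) ?_ <;>
  simp [Real.sqrt_sq (norm_nonneg _)]

theorem exists_isOrthonormalFrameOn_eq_at {κ : Type*} [Fintype κ]
    (e : OrthonormalBasis κ ℝ (TangentSpace (𝓡 n) x₀)) : ∃ U : Set M, IsOpen U ∧ x₀ ∈ U ∧
    ∃ F : κ → Π x : M, TangentSpace (𝓡 n) x, IsOrthonormalFrameOn F U ∧ ∀ k, F k x₀ = e k := by
  obtain ⟨U, hU, hx, F, hF⟩ := exists_isOrthonormalFrameOn (n := n) x₀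
  exact ⟨U, hU, hx, hF.exists_eq_at hx e⟩

end Frame

/-! ### Derivatives of scalar functions -/

section ScalarDerivative

variable {n : ℕ} {M : Type*} [TopologicalSpace M] [ChartedSpace (EuclideanSpace ℝ (Fin n)) M]
  {f g : M → ℝ} {x : M}

theorem mvfderiv_congr (h : ∀ᶠ y in nhds x, f y = g y) :
    mvfderiv (𝓡 n) f x = mvfderiv (𝓡 n) g x := by
  have h' : f =ᶠ[nhds x] g := h
  ext v
  simp only [mvfderiv, h'.mfderiv_eq]
  rfl

theorem DiffFieldAt.congr [IsManifold (𝓡 n) ∞ M] {X Y : Π x : M, TangentSpace (𝓡 n) x}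
    (hX : DiffFieldAt X x) (h : ∀ᶠ y in nhds x, Y y = X y) : DiffFieldAt Y x :=
  MDifferentiableAt.congr_of_eventuallyEq hX (h.mono fun y hy ↦ by simp only [hy])

theorem SmoothFieldOn.congr [IsManifold (𝓡 n) ∞ M] {U : Set M}
    {X Y : Π x : M, TangentSpace (𝓡 n) x} (hX : SmoothFieldOn U X) (h : ∀ x ∈ U, Y x = X x) :
    SmoothFieldOn U Y :=
  ContMDiffOn.congr hX fun x hx ↦ by simp only [h x hx]

theorem DiffAt.sum {ι : Type*} {s : Finset ι} {f : ι → M → ℝ} (hf : ∀ i ∈ s, DiffAt n (f i) x) :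
    DiffAt n (fun y ↦ ∑ i ∈ s, f i y) x := by
  classical
  induction s using Finset.induction_on with
  | empty => simpa using mdifferentiableAt_const
  | insert a s ha h =>
    simp only [Finset.sum_insert ha]
    exact MDifferentiableAt.add (hf a (by simp)) (h fun i hi ↦ hf i (by simp [hi]))

theorem mvfderiv_sum {ι : Type*} {s : Finset ι} {f : ι → M → ℝ}
    (hf : ∀ i ∈ s, DiffAt n (f i) x) (v : TangentSpace (𝓡 n) x) :
    mvfderiv (𝓡 n) (fun y ↦ ∑ i ∈ s, f i y) x v = ∑ i ∈ s, mvfderiv (𝓡 n) (f i) x v := by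
  classical
  induction s using Finset.induction_on with
  | empty => simpa using congr($(mvfderiv_const (I := 𝓡 n) (x := x) (0 : ℝ)) v)
  | insert a s ha h =>
    simp only [Finset.sum_insert ha]
    rw [← h fun i hi ↦ hf i (by simp [hi])]
    exact congr($(mvfderiv_fun_add (hf a (by simp)) (DiffAt.sum fun i hi ↦ hf i (by simp [hi]))) v)

end ScalarDerivative

/-! ### The cubic form and its covariant derivative -/

section CubicForm

variable {n : ℕ} {M : Type*} [TopologicalSpace M]
  [ChartedSpace (EuclideanSpace ℝ (Fin n)) M]
  [IsManifold (𝓡 n) ∞ M] [RiemannianBundle (fun x : M ↦ TangentSpace (𝓡 n) x)]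
  [IsContMDiffRiemannianBundle (𝓡 n) ∞ (EuclideanSpace ℝ (Fin n))
    (fun x : M ↦ TangentSpace (𝓡 n) x)]
  {D : AffineConnection n M} {ι : Type*} [Fintype ι] {F : ι → Π x : M, TangentSpace (𝓡 n) x}
  {U : Set M} {x : M} {X Y Z W : Π x : M, TangentSpace (𝓡 n) x}

/-- In an orthonormal frame `g(F i, F k)` is constant, so `(∇g)(F i, F k)` reduces to the terms
`-g(∇F i, F k) - g(F i, ∇F k)`, which are smooth. -/
theorem IsOrthonormalFrameOn.contMDiffOn_dualDifference [T2Space M] (hF : IsOrthonormalFrameOn F U)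
    (hD : IsStatistical D) (hU : IsOpen U) (i j k : ι) :
    ContMDiffOn (𝓡 n) 𝓘(ℝ, ℝ) ∞
      (fun x ↦ (inner ℝ (dualDifference D x (F i x) (F j x)) (F k x) : ℝ)) U := by
  classical
  have h₁ := (SmoothFieldOn.connection hD.smooth hU (hF.smooth j)
    (hF.smooth i)).contMDiffOn_inner (hF.smooth k)
  have h₂ := (hF.smooth i).contMDiffOn_inner
    (SmoothFieldOn.connection hD.smooth hU (hF.smooth j) (hF.smooth k))
  refine (h₁.neg.sub h₂).congr fun x hx ↦ ?_
  rw [inner_dualDifference, cubicForm, D.derivMetricTensor_apply (X := F j) x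
    ((hF.smooth i).diffFieldAt hU hx) ((hF.smooth k).diffFieldAt hU hx)]
  have h₀ : mvfderiv (𝓡 n) (fun y ↦ (inner ℝ (F i y) (F k y) : ℝ)) x = 0 := by
    rw [mvfderiv_congr (g := fun _ ↦ if i = k then 1 else 0)
      (Filter.eventually_of_mem (hU.mem_nhds hx) fun y hy ↦ hF.inner_eq hy i k)]
    exact mvfderiv_const _
  rw [h₀]
  simp

/-- Reduces the regularity of `K(X, Y)` to that of the frame coefficients of `K`. -/
theorem IsOrthonormalFrameOn.dualDifference_eq_sum (hF : IsOrthonormalFrameOn F U) (hx : x ∈ U)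
    (u v : TangentSpace (𝓡 n) x) :
    dualDifference D x u v = ∑ i, (inner ℝ (F i x) u : ℝ) • ∑ j, (inner ℝ (F j x) v : ℝ) •
      ∑ k, (inner ℝ (dualDifference D x (F i x) (F j x)) (F k x) : ℝ) • F k x := by
  simp only [real_inner_comm (F _ x) (dualDifference _ _ _ _), hF.sum_inner_smul hx]
  simp only [← map_smul, ← map_sum, hF.sum_inner_smul hx]
  conv_lhs => rw [← hF.sum_inner_smul hx u]
  simp

theorem IsStatistical.diffFieldAt_dualDifference [T2Space M] (hD : IsStatistical D) (hX : DiffFieldAt X x)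
    (hY : DiffFieldAt Y x) : DiffFieldAt (fun y ↦ dualDifference D y (X y) (Y y)) x := by
  obtain ⟨U, hU, hx, F, hF⟩ := exists_isOrthonormalFrameOn (n := n) x
  have hF' := fun i ↦ (hF.smooth i).diffFieldAt hU hx
  refine DiffFieldAt.congr (.sum fun i _ ↦ .smul ((hF' i).diffAt_inner hX) <|
    .sum fun j _ ↦ .smul ((hF' j).diffAt_inner hY) <| .sum fun k _ ↦ .smul ?_ (hF' k))
    (Filter.eventually_of_mem (hU.mem_nhds hx) fun y hy ↦ hF.dualDifference_eq_sum hy _ _)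
  exact ((hF.contMDiffOn_dualDifference hD hU i j k x hx).contMDiffAt
    (hU.mem_nhds hx)).mdifferentiableAt (by simp)

theorem IsStatistical.smoothFieldOn_dualDifference [T2Space M] (hD : IsStatistical D) (hU : IsOpen U)
    (hX : SmoothFieldOn U X) (hY : SmoothFieldOn U Y) :
    SmoothFieldOn U (fun y ↦ dualDifference D y (X y) (Y y)) := by
  intro x hx
  obtain ⟨V, hV, hxV, F, hF⟩ := exists_isOrthonormalFrameOn (n := n) x
  have hF' := hF.mono (Set.inter_subset_right (s := U))
  have hUV := hU.inter hV
  have key : SmoothFieldOn (U ∩ V) (fun y ↦ dualDifference D y (X y) (Y y)) := by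
    refine SmoothFieldOn.congr (.sum fun i _ ↦ .smul ((hF'.smooth i).contMDiffOn_inner
      (ContMDiffOn.mono hX Set.inter_subset_left)) <|
      .sum fun j _ ↦ .smul ((hF'.smooth j).contMDiffOn_inner
        (ContMDiffOn.mono hY Set.inter_subset_left)) <|
      .sum fun k _ ↦ .smul (hF'.contMDiffOn_dualDifference hD hUV i j k) (hF'.smooth k))
      (fun y hy ↦ hF'.dualDifference_eq_sum hy _ _)
  exact ((key x ⟨hx, hxV⟩).contMDiffAt (hUV.mem_nhds ⟨hx, hxV⟩)).contMDiffWithinAt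

/-- The covariant derivative at `x`, in the direction `v`, of the cubic form
`(Y, Z, W) ↦ g(K(Y, Z), W)` with respect to the `0`-connection. -/
noncomputable def derivCubic (D : AffineConnection n M) (x : M) (v : TangentSpace (𝓡 n) x)
    (Y Z W : Π x : M, TangentSpace (𝓡 n) x) : ℝ :=
  mvfderiv (𝓡 n) (fun y ↦ (inner ℝ (dualDifference D y (Y y) (Z y)) (W y) : ℝ)) x v
    - inner ℝ (dualDifference D x (alphaConnection D 0 Y x v) (Z x)) (W x)
    - inner ℝ (dualDifference D x (Y x) (alphaConnection D 0 Z x v)) (W x)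
    - inner ℝ (dualDifference D x (Y x) (Z x)) (alphaConnection D 0 W x v)

variable {v : TangentSpace (𝓡 n) x}

theorem IsStatistical.derivCubic_swap_left (hD : IsStatistical D) :
    derivCubic D x v Y Z W = derivCubic D x v Z Y W := by
  have e : (fun y ↦ (inner ℝ (dualDifference D y (Y y) (Z y)) (W y) : ℝ)) =
      fun y ↦ inner ℝ (dualDifference D y (Z y) (Y y)) (W y) :=
    funext fun y ↦ by rw [hD.dualDifference_comm y (Y y)]
  rw [derivCubic, derivCubic, e, hD.dualDifference_comm x _ (Z x),
    hD.dualDifference_comm x (Y x) (Z x),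
    hD.dualDifference_comm x (Y x) (alphaConnection D 0 Z x v)]
  ring

theorem IsStatistical.derivCubic_swap_outer (hD : IsStatistical D) :
    derivCubic D x v Y Z W = derivCubic D x v W Z Y := by
  have h (y : M) (a b c : TangentSpace (𝓡 n) y) :
      (inner ℝ (dualDifference D y a b) c : ℝ) = inner ℝ (dualDifference D y c b) a :=
    hD.inner_dualDifference_comm y a b c
  rw [derivCubic, derivCubic]
  simp only [h _ (Y _), h x (alphaConnection D 0 Y x v)]
  ring

/-- The derivative of the coefficient `f` in the Leibniz rule cancels against the one produced by
`∇⁰(f Y)`. -/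
theorem IsStatistical.tensorialAt_derivCubic [T2Space M] (hD : IsStatistical D) (hZ : DiffFieldAt Z x)
    (hW : DiffFieldAt W x) :
    TensorialAt (𝓡 n) (EuclideanSpace ℝ (Fin n)) (fun Y ↦ derivCubic D x v Y Z W) x where
  smul {f Y} hf hY := by
    have hQ := (hD.diffFieldAt_dualDifference hY hZ).diffAt_inner hW
    have h₁ : (fun y ↦ (inner ℝ (dualDifference D y ((f • Y) y) (Z y)) (W y) : ℝ)) =
        fun y ↦ f y * inner ℝ (dualDifference D y (Y y) (Z y)) (W y) := by
      funext y
      simp [inner_smul_left]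
    have h₂ : alphaConnection D 0 (f • Y) x v =
        f x • alphaConnection D 0 Y x v + mvfderiv (𝓡 n) f x v • Y x :=
      connection_smul _ hf hY v
    have h₃ := congr($(mvfderiv_fun_mul hf hQ) v)
    simp only [derivCubic, h₁, h₂, h₃]
    simp [inner_add_left, inner_smul_left]
    ring
  add {Y Y'} hY hY' := by
    have hQ := (hD.diffFieldAt_dualDifference hY hZ).diffAt_inner hW
    have hQ' := (hD.diffFieldAt_dualDifference hY' hZ).diffAt_inner hW
    have h₁ : (fun y ↦ (inner ℝ (dualDifference D y ((Y + Y') y) (Z y)) (W y) : ℝ)) =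
        fun y ↦ inner ℝ (dualDifference D y (Y y) (Z y)) (W y) +
          inner ℝ (dualDifference D y (Y' y) (Z y)) (W y) := by
      funext y
      simp [inner_add_left]
    have h₂ : alphaConnection D 0 (Y + Y') x v =
        alphaConnection D 0 Y x v + alphaConnection D 0 Y' x v :=
      connection_add _ hY hY' v
    have h₃ := congr($(mvfderiv_fun_add hQ hQ') v)
    simp only [derivCubic, h₁, h₂, h₃]
    simp [inner_add_left]
    ring

/-- `derivCubic D x v` depends only on the values of the vector fields at `x`. -/
theorem IsStatistical.derivCubic_congr [T2Space M] (hD : IsStatistical D)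
    {Y' Z' W' : Π x : M, TangentSpace (𝓡 n) x}
    (hY : DiffFieldAt Y x) (hZ : DiffFieldAt Z x) (hW : DiffFieldAt W x)
    (hY' : DiffFieldAt Y' x) (hZ' : DiffFieldAt Z' x) (hW' : DiffFieldAt W' x)
    (eY : Y x = Y' x) (eZ : Z x = Z' x) (eW : W x = W' x) :
    derivCubic D x v Y Z W = derivCubic D x v Y' Z' W' := by
  -- Tensoriality is known in the first slot only; the symmetries bring each other slot there in
  -- turn.
  rw [(hD.tensorialAt_derivCubic hZ hW).pointwise hY hY' eY, hD.derivCubic_swap_left,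
    (hD.tensorialAt_derivCubic hY' hW).pointwise hZ hZ' eZ, hD.derivCubic_swap_outer,
    (hD.tensorialAt_derivCubic hY' hZ').pointwise hW hW' eW, hD.derivCubic_swap_outer,
    hD.derivCubic_swap_left]

theorem IsStatistical.inner_connection_dualDifference [T2Space M] (hD : IsStatistical D)
    (hY : DiffFieldAt Y x) (hZ : DiffFieldAt Z x) (hW : DiffFieldAt W x) :
    (inner ℝ (alphaConnection D 0 (fun y ↦ dualDifference D y (Y y) (Z y)) x v) (W x) : ℝ) =
      derivCubic D x v Y Z W
        + inner ℝ (dualDifference D x (alphaConnection D 0 Y x v) (Z x)) (W x)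
        + inner ℝ (dualDifference D x (Y x) (alphaConnection D 0 Z x v)) (W x) := by
  rw [derivCubic, mvfderiv_inner_eq D (hD.diffFieldAt_dualDifference hY hZ) hW v]
  ring

end CubicForm

/-! ### Curvature differences and the Ricci hypothesis -/

section Ricci

variable {n : ℕ} {M : Type*} [TopologicalSpace M] [T2Space M]
  [ChartedSpace (EuclideanSpace ℝ (Fin n)) M]
  [IsManifold (𝓡 n) ∞ M] [RiemannianBundle (fun x : M ↦ TangentSpace (𝓡 n) x)]
  [IsContMDiffRiemannianBundle (𝓡 n) ∞ (EuclideanSpace ℝ (Fin n))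
    (fun x : M ↦ TangentSpace (𝓡 n) x)]
  {D : AffineConnection n M} {U : Set M} {x : M} {X Y Z W : Π x : M, TangentSpace (𝓡 n) x}

theorem IsStatistical.smoothFieldOn_alphaConnection (hD : IsStatistical D) (hU : IsOpen U)
    (hX : SmoothFieldOn U X) (hY : SmoothFieldOn U Y) (α : ℝ) :
    SmoothFieldOn U (fun x ↦ alphaConnection D α Y x (X x)) :=
  ((SmoothFieldOn.connection hD.smooth hU hX hY).add (SmoothFieldOn.smul contMDiffOn_const
    (hD.smoothFieldOn_dualDifference hU hY hX))).congr fun x _ ↦ alphaConnection_eq_add D α Y x _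

/-- The difference of the curvatures of the `α`- and the `(-α)`-connection. -/
theorem IsStatistical.inner_curvatureField_sub (hD : IsStatistical D) (α : ℝ) (hU : IsOpen U)
    (hx : x ∈ U) (hX : SmoothFieldOn U X) (hY : SmoothFieldOn U Y) (hZ : SmoothFieldOn U Z)
    (hW : DiffFieldAt W x) :
    (inner ℝ (curvatureField (alphaConnection D α) X Y Z x) (W x) : ℝ)
        - inner ℝ (curvatureField (alphaConnection D (-α)) X Y Z x) (W x) =
      -α * (derivCubic D x (X x) Z Y W - derivCubic D x (Y x) Z X W) := by
  have hX' := hX.diffFieldAt hU hx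
  have hY' := hY.diffFieldAt hU hx
  have hZ' := hZ.diffFieldAt hU hx
  -- Second covariant derivatives as polynomials in `β`: the terms of degree 0 and 2 agree for `β =
  -- α` and `β = -α`. In the linear part, the derivatives of `Z` cancel after antisymmetrization,
  -- and those of `X`, `Y` cancel against the bracket term, because `∇⁰` is torsion-free.
  have second (β : ℝ) {A B : Π x : M, TangentSpace (𝓡 n) x} (hA : SmoothFieldOn U A)
      (hB : SmoothFieldOn U B) :
      (inner ℝ (alphaConnection D β (fun y ↦ alphaConnection D β Z y (B y)) x (A x)) (W x) : ℝ) =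
        inner ℝ (alphaConnection D 0 (fun y ↦ alphaConnection D 0 Z y (B y)) x (A x)) (W x)
        - β / 2 * inner ℝ (alphaConnection D 0 (fun y ↦ dualDifference D y (Z y) (B y)) x (A x))
          (W x)
        - β / 2 * inner ℝ (dualDifference D x (alphaConnection D 0 Z x (B x)) (A x)) (W x)
        + (β / 2) ^ 2 *
          inner ℝ (dualDifference D x (dualDifference D x (Z x) (B x)) (A x)) (W x) := by
    have hP := (hD.smoothFieldOn_alphaConnection hU hB hZ 0).diffFieldAt hU hx
    have hL := hD.diffFieldAt_dualDifference hZ' (hB.diffFieldAt hU hx)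
    have e : (fun y ↦ alphaConnection D β Z y (B y)) = fun y ↦
        alphaConnection D 0 Z y (B y) - (β / 2) • dualDifference D y (Z y) (B y) :=
      funext fun y ↦ alphaConnection_eq_sub D β Z y (B y)
    rw [e, alphaConnection_eq_sub, connection_sub _ hP (.smul mdifferentiableAt_const hL),
      connection_const_smul _ _ hL]
    simp [inner_sub_left, inner_smul_left]
    ring
  have h₁ := hD.inner_connection_dualDifference (v := X x) hZ' hY' hW
  have h₂ := hD.inner_connection_dualDifference (v := Y x) hZ' hX' hW
  simp only [curvatureField, inner_sub_left, second α hX hY, second α hY hX, second (-α) hX hY,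
    second (-α) hY hX, alphaConnection_eq_sub D α Z x, alphaConnection_eq_sub D (-α) Z x,
    inner_smul_left]
  rw [hD.mlieBracket_eq 0 hX' hY']
  simp only [map_sub, inner_sub_left]
  rw [h₁, h₂]
  simp
  ring

/-- If the Ricci curvatures of the `α`- and the `(-α)`-connection agree, the trace of the covariant
derivative of the cubic form is symmetric. -/
theorem IsStatistical.sum_derivCubic_comm (hD : IsStatistical D) {α : ℝ} (hα : α ≠ 0)
    (hRic : ∀ v w : TangentSpace (𝓡 n) x,
      ricci (alphaConnection D α) x v w = ricci (alphaConnection D (-α)) x v w)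
    {F : Fin (Module.finrank ℝ (TangentSpace (𝓡 n) x)) → Π x : M, TangentSpace (𝓡 n) x}
    (hF : ∀ i, DiffFieldAt (F i) x) (hFx : ∀ i, F i x = stdOrthonormalBasis ℝ _ i)
    (hX : DiffFieldAt X x) (hY : DiffFieldAt Y x) :
    ∑ i, derivCubic D x (X x) Y (F i) (F i) = ∑ i, derivCubic D x (Y x) X (F i) (F i) := by
  -- The traced curvature difference: the divergence of `K` equals `∇⁰τ`. The left side is symmetric
  -- in `A` and `B`, which yields the claim.
  have key {A B : Π x : M, TangentSpace (𝓡 n) x} (hA : DiffFieldAt A x) (hB : DiffFieldAt B x) :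
      ∑ i, derivCubic D x (F i x) B A (F i) = ∑ i, derivCubic D x (A x) B (F i) (F i) := by
    have h := hRic (A x) (B x)
    rw [← sub_eq_zero, ricci, ricci, ← Finset.sum_sub_distrib] at h
    rw [← sub_eq_zero, ← Finset.sum_sub_distrib]
    refine (mul_eq_zero.1 ?_).resolve_left (neg_ne_zero.2 hα)
    rw [← h, Finset.mul_sum]
    refine Finset.sum_congr rfl fun i _ ↦ ?_
    obtain ⟨U₁, hU₁, hx₁, h₁⟩ :=
      exists_smoothFieldOn_extend (stdOrthonormalBasis ℝ (TangentSpace (𝓡 n) x) i)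
    obtain ⟨U₂, hU₂, hx₂, h₂⟩ := exists_smoothFieldOn_extend (A x)
    obtain ⟨U₃, hU₃, hx₃, h₃⟩ := exists_smoothFieldOn_extend (B x)
    have hc := hD.inner_curvatureField_sub α ((hU₁.inter hU₂).inter hU₃) ⟨⟨hx₁, hx₂⟩, hx₃⟩
      (h₁.mono fun _ h ↦ h.1.1) (h₂.mono fun _ h ↦ h.1.2) (h₃.mono fun _ h ↦ h.2) (hF i)
    rw [FiberBundle.extend_apply_self, FiberBundle.extend_apply_self, hFx] at hc
    rw [curvature, curvature, hc, hFx]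
    -- The curvature is computed with extensions of tangent vectors; these may be replaced by the
    -- given fields because `derivCubic` is pointwise.
    congr 2
    · exact hD.derivCubic_congr hB hA (hF i) (diffFieldAt_extend _) (diffFieldAt_extend _) (hF i)
        (by simp) (by simp) rfl
    · exact hD.derivCubic_congr hB (hF i) (hF i) (diffFieldAt_extend _) (diffFieldAt_extend _)
        (hF i) (by simp) (by simp [hFx]) rfl
  rw [← key hX hY, ← key hY hX]
  exact Finset.sum_congr rfl fun i _ ↦ hD.derivCubic_swap_left

end Ricci

/-! ### The trace form and its closedness -/

section TraceForm

variable {n : ℕ} {M : Type*} [TopologicalSpace M]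
  [ChartedSpace (EuclideanSpace ℝ (Fin n)) M]
  [IsManifold (𝓡 n) ∞ M] [RiemannianBundle (fun x : M ↦ TangentSpace (𝓡 n) x)]
  [IsContMDiffRiemannianBundle (𝓡 n) ∞ (EuclideanSpace ℝ (Fin n))
    (fun x : M ↦ TangentSpace (𝓡 n) x)]
  {D : AffineConnection n M} {U : Set M} {x : M} {X Y : Π x : M, TangentSpace (𝓡 n) x}
  {ι : Type*} [Fintype ι] {F : ι → Π x : M, TangentSpace (𝓡 n) x}

/-- The trace of the difference tensor, `v ↦ tr K(v, ·)`. -/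
noncomputable def traceForm (D : AffineConnection n M) (x : M) : TangentSpace (𝓡 n) x →ₗ[ℝ] ℝ :=
  ∑ i, (innerₗ (TangentSpace (𝓡 n) x) (stdOrthonormalBasis ℝ (TangentSpace (𝓡 n) x) i)) ∘ₗ
    ((dualDifference D x).flip (stdOrthonormalBasis ℝ (TangentSpace (𝓡 n) x) i)).toLinearMap

/-- The trace does not depend on the orthonormal basis, so the pointwise chosen standard basis can
be exchanged for a smooth frame. -/
theorem IsOrthonormalFrameOn.traceForm_eq_sum (hF : IsOrthonormalFrameOn F U) (hx : x ∈ U)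
    (v : TangentSpace (𝓡 n) x) :
    traceForm D x v = ∑ i, inner ℝ (dualDifference D x v (F i x)) (F i x) := by
  obtain ⟨b, hb⟩ := hF.exists_orthonormalBasis hx
  have h₁ := LinearMap.trace_eq_sum_inner (dualDifference D x v).toLinearMap b
  have h₂ := LinearMap.trace_eq_sum_inner (dualDifference D x v).toLinearMap
    (stdOrthonormalBasis ℝ (TangentSpace (𝓡 n) x))
  rw [h₁] at h₂
  simp only [hb] at h₂
  simp only [traceForm, LinearMap.sum_apply]
  refine h₂.symm.trans ?_
  exact Finset.sum_congr rfl fun i _ ↦ real_inner_comm _ _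

variable [T2Space M]

theorem IsStatistical.contMDiffOn_traceForm (hD : IsStatistical D) (hU : IsOpen U)
    (hX : SmoothFieldOn U X) : ContMDiffOn (𝓡 n) 𝓘(ℝ, ℝ) ∞ (fun x ↦ traceForm D x (X x)) U := by
  intro x hx
  obtain ⟨V, hV, hxV, F, hF⟩ := exists_isOrthonormalFrameOn (n := n) x
  have hUV := hU.inter hV
  have hF' := hF.mono (Set.inter_subset_right (s := U))
  have key : ContMDiffOn (𝓡 n) 𝓘(ℝ, ℝ) ∞ (fun x ↦ traceForm D x (X x)) (U ∩ V) :=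
    (contMDiffOn_finsetSum fun i _ ↦ (hD.smoothFieldOn_dualDifference hUV
      (hX.mono Set.inter_subset_left) (hF'.smooth i)).contMDiffOn_inner (hF'.smooth i)).congr
      fun y hy ↦ hF'.traceForm_eq_sum hy _
  exact ((key x ⟨hx, hxV⟩).contMDiffAt (hUV.mem_nhds ⟨hx, hxV⟩)).contMDiffWithinAt

/-- Covariant differentiation by a metric connection commutes with the metric trace; the sum on the
right is `(∇⁰_v τ)(Y)`. -/
theorem IsStatistical.mvfderiv_traceForm (hD : IsStatistical D) (hF : IsOrthonormalFrameOn F U)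
    (hU : IsOpen U) (hx : x ∈ U) (hY : DiffFieldAt Y x) (v : TangentSpace (𝓡 n) x) :
    mvfderiv (𝓡 n) (fun y ↦ traceForm D y (Y y)) x v =
      ∑ i, derivCubic D x v Y (F i) (F i) + traceForm D x (alphaConnection D 0 Y x v) := by
  classical
  have hF' := fun i ↦ (hF.smooth i).diffFieldAt hU hx
  have hd := fun i ↦ (hD.diffFieldAt_dualDifference hY (hF' i)).diffAt_inner (hF' i)
  have anti (i j : ι) : (inner ℝ (alphaConnection D 0 (F i) x v) (F j x) : ℝ) +
      inner ℝ (F i x) (alphaConnection D 0 (F j) x v) = 0 := by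
    rw [← mvfderiv_inner_eq D (hF' i) (hF' j), mvfderiv_congr (g := fun _ ↦ if i = j then 1 else 0)
      (Filter.eventually_of_mem (hU.mem_nhds hx) fun y hy ↦ hF.inner_eq hy i j)]
    exact congr($(mvfderiv_const (I := 𝓡 n) (x := x) (if i = j then (1 : ℝ) else 0)) v)
  have hsymm (i j : ι) : (inner ℝ (dualDifference D x (Y x) (F i x)) (F j x) : ℝ) =
      inner ℝ (dualDifference D x (Y x) (F j x)) (F i x) := by
    rw [hD.dualDifference_comm, hD.inner_dualDifference_comm, hD.dualDifference_comm]
  -- The sum pairs the symmetric matrix `g(K(Y, F i), F j)` with the antisymmetric connection matrix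
  -- of `∇⁰`. It occurs twice in the derivative of the trace, once for each slot holding `F i`.
  have hzero : ∑ i, (inner ℝ (dualDifference D x (Y x) (F i x))
      (alphaConnection D 0 (F i) x v) : ℝ) = 0 := by
    have h₁ : ∑ i, (inner ℝ (dualDifference D x (Y x) (F i x))
        (alphaConnection D 0 (F i) x v) : ℝ) =
        ∑ i, ∑ j, (inner ℝ (dualDifference D x (Y x) (F i x)) (F j x) : ℝ) *
          inner ℝ (F j x) (alphaConnection D 0 (F i) x v) :=
      Finset.sum_congr rfl fun i _ ↦ (hF.sum_inner_mul_inner hx _ _).symm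
    have h₂ : ∑ i, ∑ j, (inner ℝ (dualDifference D x (Y x) (F i x)) (F j x) : ℝ) *
          inner ℝ (F j x) (alphaConnection D 0 (F i) x v) =
        -∑ i, ∑ j, (inner ℝ (dualDifference D x (Y x) (F i x)) (F j x) : ℝ) *
          inner ℝ (F j x) (alphaConnection D 0 (F i) x v) := by
      conv_lhs => rw [Finset.sum_comm]
      rw [← Finset.sum_neg_distrib]
      refine Finset.sum_congr rfl fun i _ ↦ ?_
      rw [← Finset.sum_neg_distrib]
      refine Finset.sum_congr rfl fun j _ ↦ ?_
      have := anti i j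
      rw [real_inner_comm] at this
      rw [hsymm i j]
      linear_combination inner ℝ (dualDifference D x (Y x) (F j x)) (F i x) * this
    linarith
  rw [mvfderiv_congr (Filter.eventually_of_mem (hU.mem_nhds hx) fun y hy ↦
    hF.traceForm_eq_sum hy (Y y)), mvfderiv_sum (fun i _ ↦ hd i), hF.traceForm_eq_sum hx,
    ← Finset.sum_add_distrib]
  have h₄ : ∀ i, (inner ℝ (dualDifference D x (Y x) (alphaConnection D 0 (F i) x v)) (F i x) : ℝ) =
      inner ℝ (dualDifference D x (Y x) (F i x)) (alphaConnection D 0 (F i) x v) := fun i ↦ by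
    rw [hD.dualDifference_comm, hD.inner_dualDifference_comm, hD.dualDifference_comm]
  rw [← sub_eq_zero, ← Finset.sum_sub_distrib]
  simp only [derivCubic, h₄]
  refine Eq.trans ?_ (mul_eq_zero_of_right 2 hzero)
  rw [Finset.mul_sum]
  exact Finset.sum_congr rfl fun i _ ↦ by ring

/-- If the Ricci curvatures of the `α`- and the `(-α)`-connection agree, the trace form is
closed. -/
theorem IsStatistical.traceForm_closed (hD : IsStatistical D) {α : ℝ} (hα : α ≠ 0)
    (hRic : ∀ v w : TangentSpace (𝓡 n) x,
      ricci (alphaConnection D α) x v w = ricci (alphaConnection D (-α)) x v w)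
    (hX : DiffFieldAt X x) (hY : DiffFieldAt Y x) :
    mvfderiv (𝓡 n) (fun y ↦ traceForm D y (Y y)) x (X x)
      - mvfderiv (𝓡 n) (fun y ↦ traceForm D y (X y)) x (Y x)
      = traceForm D x (VectorField.mlieBracket (𝓡 n) X Y x) := by
  obtain ⟨U, hU, hx, F, hF, hFx⟩ :=
    exists_isOrthonormalFrameOn_eq_at x (stdOrthonormalBasis ℝ (TangentSpace (𝓡 n) x))
  -- The parts `∇⁰τ` cancel by symmetry, leaving `τ(∇⁰_X Y - ∇⁰_Y X)`, the value of `τ` on the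
  -- bracket.
  rw [hD.mvfderiv_traceForm hF hU hx hY, hD.mvfderiv_traceForm hF hU hx hX,
    hD.sum_derivCubic_comm hα hRic (fun i ↦ (hF.smooth i).diffFieldAt hU hx) hFx hX hY,
    hD.mlieBracket_eq 0 hX hY, map_sub]
  ring

end TraceForm

/-! ### Constant vector fields on a normed space -/

section ConstantFields

variable {E : Type*} [NormedAddCommGroup E] [NormedSpace ℝ E]

theorem contMDiffAt_const_section (b y : E) :
    ContMDiffAt 𝓘(ℝ, E) (𝓘(ℝ, E)).tangent ∞ (fun z ↦ (⟨z, b⟩ : TangentBundle 𝓘(ℝ, E) E)) y :=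
  contMDiffAt_vectorSpace_iff_contDiffAt.2 contDiffAt_const

theorem mlieBracket_const (a b x : E) :
    VectorField.mlieBracket 𝓘(ℝ, E) (fun _ ↦ a) (fun _ ↦ b) x = 0 := by
  refine (congrFun (VectorField.mlieBracketWithin_eq_lieBracketWithin (s := Set.univ)) x).trans ?_
  have h : VectorField.lieBracket ℝ (fun _ : E ↦ a) (fun _ ↦ b) x = 0 := by
    simp [VectorField.lieBracket]
  rwa [VectorField.lieBracketWithin_univ]

end ConstantFields

/-! ### Coordinate fields and the Poincaré lemma -/

section Poincare

variable {n : ℕ} {M : Type*} [TopologicalSpace M] [ChartedSpace (EuclideanSpace ℝ (Fin n)) M]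
  [IsManifold (𝓡 n) ∞ M]

/-- The vector field with constant coefficients `b` in the chart at `x₀`. -/
noncomputable def coordField (x₀ : M) (b : EuclideanSpace ℝ (Fin n)) (x : M) :
    TangentSpace (𝓡 n) x :=
  VectorField.mpullback (𝓡 n) 𝓘(ℝ, EuclideanSpace ℝ (Fin n)) (extChartAt (𝓡 n) x₀)
    (fun _ ↦ b) x

variable {x₀ x : M}

theorem smoothFieldOn_coordField (x₀ : M) (b : EuclideanSpace ℝ (Fin n)) :
    SmoothFieldOn (extChartAt (𝓡 n) x₀).source (coordField x₀ b) := fun x hx ↦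
  (ContMDiffAt.mpullback_vectorField_preimage (n := ∞) (contMDiffAt_const_section b _)
    (contMDiffAt_extChartAt' (by simpa using hx)) (isInvertible_mfderiv_extChartAt hx)
    (by simp)).contMDiffWithinAt

theorem mfderiv_coordField (hx : x ∈ (extChartAt (𝓡 n) x₀).source)
    (b : EuclideanSpace ℝ (Fin n)) :
    mfderiv (𝓡 n) 𝓘(ℝ, EuclideanSpace ℝ (Fin n)) (extChartAt (𝓡 n) x₀) x (coordField x₀ b x) =
      b :=
  (isInvertible_mfderiv_extChartAt hx).self_apply_inverse _

theorem coordField_mfderiv (hx : x ∈ (extChartAt (𝓡 n) x₀).source) (v : TangentSpace (𝓡 n) x) :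
    coordField x₀
      (mfderiv (𝓡 n) 𝓘(ℝ, EuclideanSpace ℝ (Fin n)) (extChartAt (𝓡 n) x₀) x v) x = v :=
  (isInvertible_mfderiv_extChartAt hx).inverse_apply_self _

theorem mlieBracket_coordField (hx : x ∈ (extChartAt (𝓡 n) x₀).source)
    (a b : EuclideanSpace ℝ (Fin n)) :
    VectorField.mlieBracket (𝓡 n) (coordField x₀ a) (coordField x₀ b) x = 0 := by
  have : IsManifold (𝓡 n) (minSmoothness ℝ 2) M := IsManifold.of_le (n := ∞) (by simpa using ENat.LEInfty.out)
  have h := VectorField.mpullback_mlieBracket (n := ∞) (I := 𝓡 n) (f := extChartAt (𝓡 n) x₀)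
    (x₀ := x)
    ((contMDiffAt_const_section a _).mdifferentiableAt (by simp))
    ((contMDiffAt_const_section b _).mdifferentiableAt (by simp))
    (contMDiffAt_extChartAt' (by simpa using hx)) (by simpa using ENat.LEInfty.out)
  refine h.symm.trans ?_
  rw [VectorField.mpullback_apply]
  exact (congrArg _ (mlieBracket_const a b _)).trans (map_zero _)

/-- The Poincaré lemma for fields of covectors on a manifold. -/
theorem exists_potential (τ : Π x : M, TangentSpace (𝓡 n) x →ₗ[ℝ] ℝ)
    (hτ : ∀ (U : Set M) (X : Π x : M, TangentSpace (𝓡 n) x), IsOpen U → SmoothFieldOn U X →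
      ContMDiffOn (𝓡 n) 𝓘(ℝ, ℝ) ∞ (fun x ↦ τ x (X x)) U)
    (hclosed : ∀ (x : M) (X Y : Π x : M, TangentSpace (𝓡 n) x), DiffFieldAt X x →
      DiffFieldAt Y x → mvfderiv (𝓡 n) (fun y ↦ τ y (Y y)) x (X x)
        - mvfderiv (𝓡 n) (fun y ↦ τ y (X y)) x (Y x)
        = τ x (VectorField.mlieBracket (𝓡 n) X Y x)) (x₀ : M) :
    ∃ U : Set M, IsOpen U ∧ x₀ ∈ U ∧ ∃ f : M → ℝ, ContMDiffOn (𝓡 n) 𝓘(ℝ, ℝ) ∞ f U ∧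
      ∀ x ∈ U, ∀ v : TangentSpace (𝓡 n) x, mvfderiv (𝓡 n) f x v = τ x v := by
  set φ := extChartAt (𝓡 n) x₀ with hφ
  have hS : IsOpen φ.source := isOpen_extChartAt_source x₀
  have hT : IsOpen φ.target := isOpen_extChartAt_target x₀
  -- The covector field `τ` read in the chart at `x₀`; its coefficient on `b` is `τ` of the
  -- coordinate field of `b`.
  let θ : EuclideanSpace ℝ (Fin n) → EuclideanSpace ℝ (Fin n) →L[ℝ] ℝ := fun y ↦
    LinearMap.toContinuousLinearMap ((τ (φ.symm y)).comp
      (mfderiv (𝓡 n) 𝓘(ℝ, EuclideanSpace ℝ (Fin n)) φ (φ.symm y)).inverse.toLinearMap)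
  have hθ : ∀ y b, θ y b = τ (φ.symm y) (coordField x₀ b (φ.symm y)) := fun y b ↦ rfl
  have hθφ {x : M} (hx : x ∈ φ.source) (b : EuclideanSpace ℝ (Fin n)) :
      θ (φ x) b = τ x (coordField x₀ b x) := by
    rw [hθ, φ.left_inv hx]
  have hθc (b : EuclideanSpace ℝ (Fin n)) : ContDiffOn ℝ ∞ (fun y ↦ θ y b) φ.target := by
    rw [← contMDiffOn_iff_contDiffOn]
    exact (hτ φ.source (coordField x₀ b) hS (smoothFieldOn_coordField x₀ b)).comp
      (contMDiffOn_extChartAt_symm x₀) fun y hy ↦ φ.map_target hy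
  have hθs : ContDiffOn ℝ ∞ θ φ.target := contDiffOn_clm_apply.2 hθc
  have hφd {x : M} (hx : x ∈ φ.source) :
      MDifferentiableAt (𝓡 n) 𝓘(ℝ, EuclideanSpace ℝ (Fin n)) φ x :=
    (contMDiffAt_extChartAt' (n := ∞) (by simpa [hφ] using hx)).mdifferentiableAt (by simp)
  have hcomp {g : EuclideanSpace ℝ (Fin n) → ℝ} {x : M} (hx : x ∈ φ.source)
      (hg : DifferentiableAt ℝ g (φ x)) (v : TangentSpace (𝓡 n) x) :
      mvfderiv (𝓡 n) (g ∘ φ) x v =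
        fderiv ℝ g (φ x) (mfderiv (𝓡 n) 𝓘(ℝ, EuclideanSpace ℝ (Fin n)) φ x v) := by
    rw [mvfderiv_comp_apply x hg.mdifferentiableAt (hφd hx) v, mvfderiv, mfderiv_eq_fderiv]
    rfl
  have hfderiv {y : EuclideanSpace ℝ (Fin n)} (hy : y ∈ φ.target)
      (a b : EuclideanSpace ℝ (Fin n)) : fderiv ℝ θ y a b =
        mvfderiv (𝓡 n) (fun x ↦ τ x (coordField x₀ b x)) (φ.symm y)
          (coordField x₀ a (φ.symm y)) := by
    have hx := φ.map_target hy
    have hd := (hθs.contDiffAt (hT.mem_nhds hy)).differentiableAt (by simp)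
    have hdb : DifferentiableAt ℝ (fun z ↦ θ z b) (φ (φ.symm y)) := by
      rw [φ.right_inv hy]
      exact hd.clm_apply (differentiableAt_const b)
    rw [mvfderiv_congr (g := (fun z ↦ θ z b) ∘ φ) (Filter.eventually_of_mem (hS.mem_nhds hx)
      fun x hx ↦ (hθφ hx b).symm), hcomp hx hdb,
      mfderiv_coordField hx, φ.right_inv hy, fderiv_clm_apply hd (differentiableAt_const b)]
    simp
  -- Coordinate fields commute, so closedness becomes symmetry of the derivative of `θ`.
  have hsymm {y : EuclideanSpace ℝ (Fin n)} (hy : y ∈ φ.target)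
      (a b : EuclideanSpace ℝ (Fin n)) : fderiv ℝ θ y a b = fderiv ℝ θ y b a := by
    have hx := φ.map_target hy
    rw [hfderiv hy, hfderiv hy, ← sub_eq_zero, hclosed _ _ _
      ((smoothFieldOn_coordField x₀ a).diffFieldAt hS hx)
      ((smoothFieldOn_coordField x₀ b).diffFieldAt hS hx), mlieBracket_coordField hx, map_zero]
  -- A ball inside the chart target provides the convex domain for the Euclidean Poincaré lemma.
  obtain ⟨r, hr, hB⟩ := Metric.isOpen_iff.1 hT (φ x₀) (mem_extChartAt_target x₀)
  obtain ⟨g, hg⟩ := (convex_ball (φ x₀) r).exists_forall_hasFDerivAt_of_fderiv_symmetric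
    Metric.isOpen_ball ((hθs.mono hB).differentiableOn (by simp)) fun y hy ↦ hsymm (hB hy)
  have hgs : ContDiffOn ℝ ∞ g (Metric.ball (φ x₀) r) := by
    rw [contDiffOn_infty_iff_fderiv_of_isOpen Metric.isOpen_ball]
    exact ⟨fun y hy ↦ (hg y hy).differentiableAt.differentiableWithinAt,
      (hθs.mono hB).congr fun y hy ↦ (hg y hy).fderiv⟩
  refine ⟨φ.source ∩ φ ⁻¹' Metric.ball (φ x₀) r, ?_, ⟨mem_extChartAt_source x₀, by simpa using hr⟩,
    g ∘ φ, ?_, fun x hx v ↦ ?_⟩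
  · have := isOpen_extChartAt_preimage (I := 𝓡 n) x₀ (Metric.isOpen_ball (x := φ x₀) (ε := r))
    rwa [← extChartAt_source (𝓡 n)] at this
  · exact (contMDiffOn_iff_contDiffOn.2 hgs).comp
      ((contMDiffOn_extChartAt (n := ∞)).mono fun x hx ↦ by simpa [hφ] using hx.1) fun x hx ↦ hx.2
  · rw [hcomp hx.1 (hg _ hx.2).differentiableAt, (hg _ hx.2).fderiv]
    exact (hθφ hx.1 _).trans (congrArg (τ x) (coordField_mfderiv hx.1 v))

end Poincare

/-! ### Derivatives of determinants -/

section Determinant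

/-- By Cramer's rule, replacing row `i` by `w` gives the determinant `(w * adj A) i`. The sum is
therefore `tr (A B adj A) = tr (B adj A A)`. -/
theorem sum_det_updateRow_mul {ι R : Type*} [Fintype ι] [DecidableEq ι] [CommRing R]
    (A B : Matrix ι ι R) : ∑ i, (A.updateRow i ((A * B) i)).det = B.trace * A.det := by
  have h : ∀ i, (A.updateRow i ((A * B) i)).det = (A * B * A.adjugate) i i := fun i ↦ by
    rw [← Matrix.cramer_transpose_apply, Matrix.cramer_eq_adjugate_mulVec,
      ← Matrix.adjugate_transpose, Matrix.mulVec_transpose]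
    exact congrFun (Matrix.mul_apply_eq_vecMul (A * B) A.adjugate i).symm i
  simp only [h]
  change (A * B * A.adjugate).trace = _
  rw [Matrix.mul_assoc, Matrix.trace_mul_comm, Matrix.mul_assoc, Matrix.adjugate_mul]
  simp [mul_comm]

variable {n : ℕ} {M : Type*} [TopologicalSpace M] [ChartedSpace (EuclideanSpace ℝ (Fin n)) M]
  {x : M} {m : ℕ} {C : M → Matrix (Fin m) (Fin m) ℝ}

theorem contMDiffOn_det {U : Set M}
    (hC : ∀ i j, ContMDiffOn (𝓡 n) 𝓘(ℝ, ℝ) ∞ (fun y ↦ C y i j) U) :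
    ContMDiffOn (𝓡 n) 𝓘(ℝ, ℝ) ∞ (fun y ↦ (C y).det) U := by
  simp only [Matrix.det_apply']
  exact contMDiffOn_finsetSum fun σ _ ↦ contMDiffOn_const.mul
    (contMDiffOn_finsetProd fun i _ ↦ hC _ _)

/-- The determinant is multilinear in the rows, so its derivative varies one row at a time. -/
theorem mvfderiv_det (hC : ∀ i j, ContMDiffAt (𝓡 n) 𝓘(ℝ, ℝ) ∞ (fun y ↦ C y i j) x)
    (v : TangentSpace (𝓡 n) x) :
    mvfderiv (𝓡 n) (fun y ↦ (C y).det) x v =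
      ∑ i, ((C x).updateRow i (fun j ↦ mvfderiv (𝓡 n) (fun y ↦ C y i j) x v)).det := by
  let c : M → Fin m → Fin m → ℝ := fun y ↦ C y
  have hc : MDifferentiableAt (𝓡 n) 𝓘(ℝ, Fin m → Fin m → ℝ) c x :=
    (contMDiffAt_pi_space.2 fun i ↦ contMDiffAt_pi_space.2 fun j ↦ hC i j).mdifferentiableAt
      (by simp)
  let d : ContinuousMultilinearMap ℝ (fun _ : Fin m ↦ Fin m → ℝ) ℝ :=
    ⟨Matrix.detRowAlternating.toMultilinearMap, Continuous.matrix_det continuous_id⟩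
  have hcomp {g : (Fin m → Fin m → ℝ) → ℝ} {g' : (Fin m → Fin m → ℝ) →L[ℝ] ℝ}
      (hg : HasFDerivAt g g' (c x)) :
      mvfderiv (𝓡 n) (g ∘ c) x v = g' (mfderiv (𝓡 n) 𝓘(ℝ, Fin m → Fin m → ℝ) c x v) := by
    rw [mvfderiv_comp_apply x hg.differentiableAt.mdifferentiableAt hc v, mvfderiv,
      mfderiv_eq_fderiv, hg.fderiv]
    rfl
  have hentry (i j : Fin m) : mvfderiv (𝓡 n) (fun y ↦ C y i j) x v =
      mfderiv (𝓡 n) 𝓘(ℝ, Fin m → Fin m → ℝ) c x v i j :=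
    hcomp (g := fun A ↦ A i j) (((ContinuousLinearMap.proj (R := ℝ) (φ := fun _ : Fin m ↦ ℝ) j).comp
      (ContinuousLinearMap.proj (R := ℝ) (φ := fun _ : Fin m ↦ Fin m → ℝ) i)).hasFDerivAt)
  simp only [hentry]
  exact (hcomp (g := d) (d.hasFDerivAt (c x))).trans (d.linearDeriv_apply (c x) _)

end Determinant

/-! ### The parallel volume form -/

section VolumeForm

variable {n : ℕ} {M : Type*} [TopologicalSpace M] [ChartedSpace (EuclideanSpace ℝ (Fin n)) M]
  [RiemannianBundle (fun x : M ↦ TangentSpace (𝓡 n) x)]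

/-- The top form with density `ρ` in the orthonormal frame `F`. -/
noncomputable def frameForm (ρ : M → ℝ) (F : Fin n → Π x : M, TangentSpace (𝓡 n) x) :
    TopForm n M := fun x ↦
  ρ x • (Matrix.detRowAlternating (R := ℝ) (n := Fin n)).compLinearMap
    (LinearMap.pi fun i ↦ innerₗ (TangentSpace (𝓡 n) x) (F i x))

theorem frameForm_apply (ρ : M → ℝ) (F : Fin n → Π x : M, TangentSpace (𝓡 n) x) (x : M)
    (v : Fin n → TangentSpace (𝓡 n) x) :
    frameForm ρ F x v = ρ x * (Matrix.of fun j i ↦ (inner ℝ (F i x) (v j) : ℝ)).det := rfl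

variable [IsManifold (𝓡 n) ∞ M]
  [IsContMDiffRiemannianBundle (𝓡 n) ∞ (EuclideanSpace ℝ (Fin n))
    (fun x : M ↦ TangentSpace (𝓡 n) x)]
  {D : AffineConnection n M} {U : Set M} {F : Fin n → Π x : M, TangentSpace (𝓡 n) x}
  {f : M → ℝ}

theorem IsOrthonormalFrameOn.isVolumeFormOn_frameForm (hF : IsOrthonormalFrameOn F U)
    {ρ : M → ℝ} (hρ : ContMDiffOn (𝓡 n) 𝓘(ℝ, ℝ) ∞ ρ U) (hρ₀ : ∀ x ∈ U, ρ x ≠ 0) :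
    IsVolumeFormOn (frameForm ρ F) U where
  smooth X hX := by
    simp only [frameForm_apply]
    exact hρ.mul (contMDiffOn_det fun i j ↦ (hF.smooth j).contMDiffOn_inner (hX i))
  ne_zero x hx h := by
    -- On the frame itself the Gram matrix is the identity, so the form takes the value `ρ x`.
    have h₁ := congr($h (fun i ↦ F i x))
    have h₂ : (Matrix.of fun j i ↦ (inner ℝ (F i x) (F j x) : ℝ)) = 1 := by
      ext j i
      simp [hF.inner_eq hx, Matrix.one_apply, eq_comm]
    rw [frameForm_apply, h₂] at h₁
    simp [hρ₀ x hx] at h₁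

/-- The form with density 1 has covariant derivative `(α/2) τ` times itself, and the logarithmic
derivative of `exp(-(α/2) f)` is `-(α/2) τ`. -/
theorem IsStatistical.isParallelOn_frameForm [T2Space M] (hD : IsStatistical D) (α : ℝ)
    (hF : IsOrthonormalFrameOn F U) (hU : IsOpen U) (hf : ContMDiffOn (𝓡 n) 𝓘(ℝ, ℝ) ∞ f U)
    (hdf : ∀ x ∈ U, ∀ v : TangentSpace (𝓡 n) x, mvfderiv (𝓡 n) f x v = traceForm D x v) :
    IsParallelOn (alphaConnection D α) (frameForm (fun x ↦ Real.exp (-(α / 2) * f x)) F) U := by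
  intro X hX x hx v
  have hU' := hU.mem_nhds hx
  have hX' := fun j ↦ (hX j).diffFieldAt hU hx
  have hF' := fun i ↦ (hF.smooth i).diffFieldAt hU hx
  set C : M → Matrix (Fin n) (Fin n) ℝ := fun y ↦ Matrix.of fun j i ↦ inner ℝ (F i y) (X j y)
    with hC
  have hCs (j i : Fin n) : ContMDiffOn (𝓡 n) 𝓘(ℝ, ℝ) ∞ (fun y ↦ C y j i) U :=
    (hF.smooth i).contMDiffOn_inner (hX j)
  have hfd : DiffAt n f x := ((hf x hx).contMDiffAt hU').mdifferentiableAt (by simp)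
  have hdd : DiffAt n (fun y ↦ (C y).det) x :=
    (((contMDiffOn_det hCs) x hx).contMDiffAt hU').mdifferentiableAt (by simp)
  have hexp : HasDerivAt (fun s : ℝ ↦ Real.exp (-(α / 2) * s))
      (Real.exp (-(α / 2) * f x) * -(α / 2)) (f x) := by
    simpa using ((hasDerivAt_id (f x)).const_mul (-(α / 2))).exp
  have hρd : DiffAt n (fun y ↦ Real.exp (-(α / 2) * f y)) x :=
    MDifferentiableAt.comp (g := fun s : ℝ ↦ Real.exp (-(α / 2) * s)) x
      hexp.differentiableAt.mdifferentiableAt hfd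
  have hρ : mvfderiv (𝓡 n) (fun y ↦ Real.exp (-(α / 2) * f y)) x v =
      Real.exp (-(α / 2) * f x) * -(α / 2) * traceForm D x v := by
    rw [← hdf x hx v]
    refine (mvfderiv_comp_apply x hexp.differentiableAt.mdifferentiableAt hfd v).trans ?_
    rw [mvfderiv, mfderiv_eq_fderiv, hexp.hasFDerivAt.fderiv]
    exact mul_comm _ _
  have hdet := mvfderiv_det (fun i j ↦ (hCs i j x hx).contMDiffAt hU') v
  have hdC (j i : Fin n) : mvfderiv (𝓡 n) (fun y ↦ C y j i) x v =
      inner ℝ (alphaConnection D 0 (F i) x v) (X j x) +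
        inner ℝ (F i x) (alphaConnection D 0 (X j) x v) :=
    mvfderiv_inner_eq D (hF' i) (hX' j) v
  -- the connection matrix of the `α`-connection in the frame `F`
  set B : Matrix (Fin n) (Fin n) ℝ := Matrix.of fun k i ↦ inner ℝ (F k x)
    (alphaConnection D 0 (F i) x v + (α / 2) • dualDifference D x (F i x) v) with hB
  -- Duality of `∇^(α)` and `∇^(-α) = ∇⁰ + (α/2) K`: `v g(F i, X j) = g(∇^(-α)_v F i, X j) + g(F i,
  -- ∇^(α)_v X j)`.
  have hCB (j i : Fin n) : (C x * B) j i = mvfderiv (𝓡 n) (fun y ↦ C y j i) x v -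
      inner ℝ (F i x) (alphaConnection D α (X j) x v) := by
    have h₁ : (inner ℝ (F i x) (dualDifference D x (X j x) v) : ℝ) =
        inner ℝ (X j x) (dualDifference D x (F i x) v) := by
      rw [real_inner_comm, real_inner_comm _ (X j x), hD.inner_dualDifference_comm]
    have h₂ : (C x * B) j i = ∑ k, (inner ℝ (X j x) (F k x) : ℝ) * inner ℝ (F k x)
        (alphaConnection D 0 (F i) x v + (α / 2) • dualDifference D x (F i x) v) := by
      rw [Matrix.mul_apply]
      exact Finset.sum_congr rfl fun k _ ↦ by rw [real_inner_comm]; rfl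
    rw [h₂, hF.sum_inner_mul_inner hx, hdC, alphaConnection_eq_sub D α (X j), inner_sub_right,
      inner_add_right, inner_smul_right, inner_smul_right, h₁, real_inner_comm (X j x)]
    ring
  -- Since each `F i` has unit length, `∇⁰_v F i` is orthogonal to it; only the term in `K`
  -- contributes to the trace.
  have htr : B.trace = α / 2 * traceForm D x v := by
    have h₀ (i : Fin n) : (inner ℝ (F i x) (alphaConnection D 0 (F i) x v) : ℝ) = 0 := by
      have h := mvfderiv_inner_eq D (hF' i) (hF' i) v
      rw [mvfderiv_congr (g := fun _ ↦ 1) (Filter.eventually_of_mem hU' fun y hy ↦ by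
        rw [hF.inner_eq hy, if_pos rfl]), real_inner_comm] at h
      have h' := congr($(mvfderiv_const (I := 𝓡 n) (x := x) (1 : ℝ)) v)
      have h₁ := h'.symm.trans h
      simp only [zero_apply] at h₁
      linarith
    rw [hF.traceForm_eq_sum hx, Finset.mul_sum, Matrix.trace]
    refine Finset.sum_congr rfl fun i _ ↦ ?_
    rw [Matrix.diag_apply, hB, Matrix.of_apply, inner_add_right, h₀, inner_smul_right,
      hD.dualDifference_comm x v, real_inner_comm, zero_add]
  have hsum := sum_det_updateRow_mul (C x) B
  -- By `hCB` the row of `∇^(α)_v X j` is the derivative of row `j` of `C` minus row `j` of `C * B`.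
  -- Summed over `j`, the first part gives the derivative of `det C` and the second gives `tr B *
  -- det C`.
  have hterm (j : Fin n) : frameForm (fun x ↦ Real.exp (-(α / 2) * f x)) F x
      (Function.update (fun k ↦ X k x) j (alphaConnection D α (X j) x v)) =
      Real.exp (-(α / 2) * f x) *
        (((C x).updateRow j (fun i ↦ mvfderiv (𝓡 n) (fun y ↦ C y j i) x v)).det -
          ((C x).updateRow j ((C x * B) j)).det) := by
    have h₁ : (fun i ↦ mvfderiv (𝓡 n) (fun y ↦ C y j i) x v) =
        (C x * B) j + fun i ↦ inner ℝ (F i x) (alphaConnection D α (X j) x v) := by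
      funext i
      simp [hCB]
    rw [frameForm_apply, h₁, Matrix.det_updateRow_add, add_sub_cancel_left]
    congr 2
    ext k i
    by_cases hk : k = j
    · subst hk
      simp
    · simp [hk, hC]
  have hval : (fun y ↦ frameForm (fun x ↦ Real.exp (-(α / 2) * f x)) F y fun i ↦ X i y) =
      fun y ↦ Real.exp (-(α / 2) * f y) * (C y).det := rfl
  have hprod : mvfderiv (𝓡 n) (fun y ↦ Real.exp (-(α / 2) * f y) * (C y).det) x v =
      Real.exp (-(α / 2) * f x) * mvfderiv (𝓡 n) (fun y ↦ (C y).det) x v +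
        (C x).det * mvfderiv (𝓡 n) (fun y ↦ Real.exp (-(α / 2) * f y)) x v := by
    simpa using congr($(mvfderiv_fun_mul hρd hdd) v)
  rw [covDerivForm, hval, hprod, hρ, hdet]
  simp only [hterm]
  rw [← Finset.mul_sum, Finset.sum_sub_distrib, hsum, htr]
  ring

end VolumeForm

end StatisticalGeometry

theorem theorem3p2 {n : ℕ} {M : Type*} [TopologicalSpace M] [T2Space M]
    [ChartedSpace (EuclideanSpace ℝ (Fin n)) M] [IsManifold (𝓡 n) ∞ M]
    [RiemannianBundle (fun x : M ↦ TangentSpace (𝓡 n) x)]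
    [IsContMDiffRiemannianBundle (𝓡 n) ∞ (EuclideanSpace ℝ (Fin n))
      (fun x : M ↦ TangentSpace (𝓡 n) x)]
    (D : StatisticalGeometry.AffineConnection n M) (hD : StatisticalGeometry.IsStatistical D)
    (hRic : ∃ α₀ : ℝ, α₀ ≠ 0 ∧ ∀ (x : M) (v w : TangentSpace (𝓡 n) x),
      StatisticalGeometry.ricci (StatisticalGeometry.alphaConnection D α₀) x v w =
        StatisticalGeometry.ricci (StatisticalGeometry.alphaConnection D (-α₀)) x v w)
    (α : ℝ) :
    StatisticalGeometry.IsEquiaffine (StatisticalGeometry.alphaConnection D α) := by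
  obtain ⟨α₀, hα₀, hRic⟩ := hRic
  refine ⟨hD.torsion_alphaConnection α, fun x₀ ↦ ?_⟩
  obtain ⟨U, hU, hxU, f, hf, hdf⟩ := StatisticalGeometry.exists_potential
    (StatisticalGeometry.traceForm D) (fun U X hU hX ↦ hD.contMDiffOn_traceForm hU hX)
    (fun x X Y hX hY ↦ hD.traceForm_closed hα₀ (hRic x) hX hY) x₀
  obtain ⟨V, hV, hxV, F, hF⟩ := StatisticalGeometry.exists_isOrthonormalFrameOn (n := n) x₀
  have hF' := hF.mono (Set.inter_subset_right (s := U))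
  have hf' := hf.mono (Set.inter_subset_left (t := V))
  -- The form is fixed by unification: `frameForm` with density `exp(-(α/2) f)`.
  refine ⟨U ∩ V, hU.inter hV, ⟨hxU, hxV⟩, _, hF'.isVolumeFormOn_frameForm ?_ fun x _ ↦
    (Real.exp_pos _).ne', hD.isParallelOn_frameForm α hF' (hU.inter hV) hf' fun x hx ↦
      hdf x hx.1⟩
  exact (Real.contDiff_exp.comp (contDiff_const.mul contDiff_id)).contMDiff.comp_contMDiffOn hf'
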